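/- Let $0<\rho<\ln\sqrt[4]{\frac{4\pi}{\pi-2}}$. Consider the boundary value problem \[ -u''(t)=\lambda\,\sin\Bigl(\frac{3}{2}\pi t\Bigr)\frac{e^{u(t)}}{\int_0^1 e^{u(x)}\,dx},\quad t\in(0,1),\qquad u(0)=u(1)=0,\tag{1} \] and the associated integral equation \[ u(t)=\lambda\int_0^1 k(t,s)\,\frac{\sin\bigl(\frac32\pi s\bigr)e^{u(s)}}{\int_0^1 e^{u(x)}\,dx}\,ds,\quad t\in[0,1],\tag{2} \] where $k(t,s)=t(1-s)$ for $0\le t\le s\le 1$ and $k(t,s)=s(1-t)$ for $0\le s\le t\le 1$. Here $\lambda\in\mathbb R$, $u\in C([0,1])$, $\|u\|_\infty=\sup_{t\in[0,1]}|u(t)|$, and solutions of (1) are classical (continuous on $[0,1]$, twice differentiable on $(0,1)$). Put \[ F_\rho(t)=e^{-2\rho}\int_0^{2/3}k(t,s)\sin\Bigl(\frac32\pi s\Bigr)ds+e^{2\rho}\int_{2/3}^1k(t,s)\sin\Bigl(\frac32\pi s\Bigr)ds, \qquad t_\rho=\frac{2}{3\pi}\arccos\Bigl(e^{4\rho}\,\frac{\pi-2}{3\pi}-\frac13\Bigr).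 \] Then: (i) there exist $\lambda^+>0$, $\lambda^-<0$ and $u^+,u^-\in C([0,1])$ with $\|u^+\|_\infty=\|u^-\|_\infty=\rho$ such that $(\lambda^+,u^+)$ and $(\lambda^-,u^-)$ solve (2), and also (1); (ii) $t_\rho\in[0,1]$ is a maximum point of $F_\rho$ on $[0,1]$, and $F_\rho(t_\rho)>0$; (iii) if $\lambda\in\mathbb R$ and $u\in C([0,1])$ with $\|u\|_\infty=\rho$ solve (1) or (2), then $|\lambda|\le \rho/F_\rho(t_\rho)$. -/

import Mathlib

noncomputable section

namespace DirichletExample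

/-- The Green's function of `-u''` on `[0,1]` with the conditions `u(0) = u(1) = 0`
(used for `t, s ∈ [0,1]`). -/
def green (t s : ℝ) : ℝ := if t ≤ s then t * (1 - s) else s * (1 - t)

/-- The extension of `u ∈ C([0,1])` to the real line by its values at the endpoints. Only its
values on `[0,1]` and its derivatives at points of `(0,1)` are used. -/
def ext (u : C(unitInterval, ℝ)) : ℝ → ℝ := Set.IccExtend zero_le_one u

/-- The right-hand side `sin(3πt/2) e^{u(t)} / ∫₀¹ e^{u(x)} dx`. -/
def rhs (u : C(unitInterval, ℝ)) (t : ℝ) : ℝ :=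
  Real.sin (3 / 2 * Real.pi * t) * Real.exp (ext u t) / ∫ x in (0 : ℝ)..1, Real.exp (ext u x)

/-- `u` is a classical solution of `-u''(t) = l sin(3πt/2) e^{u(t)} / ∫₀¹ e^{u(x)} dx`
for `t ∈ (0,1)`, with `u(0) = u(1) = 0`. -/
def SolvesBVP (l : ℝ) (u : C(unitInterval, ℝ)) : Prop :=
  (∀ t ∈ Set.Ioo (0 : ℝ) 1,
    DifferentiableAt ℝ (ext u) t ∧ HasDerivAt (deriv (ext u)) (-(l * rhs u t)) t) ∧
  u 0 = 0 ∧ u 1 = 0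

/-- `u(t) = l ∫₀¹ k(t,s) sin(3πs/2) e^{u(s)} / (∫₀¹ e^{u(x)} dx) ds` for all `t ∈ [0,1]`. -/
def SolvesIntegralEq (l : ℝ) (u : C(unitInterval, ℝ)) : Prop :=
  ∀ t : unitInterval, u t = l * ∫ s in (0 : ℝ)..1, green t s * rhs u s

/-- The lower bound function `F_ρ(t)`:
`e^{-2ρ} ∫₀^{2/3} k(t,s) sin(3πs/2) ds + e^{2ρ} ∫_{2/3}^1 k(t,s) sin(3πs/2) ds`. -/
def lowerF (ρ t : ℝ) : ℝ :=
  Real.exp (-2 * ρ) * (∫ s in (0 : ℝ)..(2 / 3), green t s * Real.sin (3 / 2 * Real.pi * s)) +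
  Real.exp (2 * ρ) * (∫ s in (2 / 3 : ℝ)..1, green t s * Real.sin (3 / 2 * Real.pi * s))

/-- The point `t_ρ`. -/
def tpt (ρ : ℝ) : ℝ :=
  2 / (3 * Real.pi) *
    Real.arccos (Real.exp (4 * ρ) * ((Real.pi - 2) / (3 * Real.pi)) - 1 / 3)

end DirichletExample

end

/-!
Write `p(t) = sin(3πt/2)`, positive on `(0, 2/3)` and negative on `(2/3, 1)`.

*Bound on the parameter.* If `‖u‖ = ρ`, the factor `e^{u(s)} / ∫ e^u` lies in `[e^{-2ρ}, e^{2ρ}]`.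
Putting the lower end where `p ≥ 0` and the upper end where `p ≤ 0` gives
`lowerF ρ t ≤ ∫ k(t,s) p(s) e^{u(s)} / ∫ e^u ds` (`lowerF_le_integral`), and the integral equation
at `t = tpt ρ` bounds `|λ|`. A boundary value solution satisfies the integral equation, since the
Dirichlet problem for `-w'' = q` has only one solution, the Green potential of `q`
(`eq_greenPotential`).

*The maximum of `lowerF ρ`.* On `[0, 2/3]` the function is a positive multiple of
`sin x - κ x` with `x = 3πt/2` and `κ = critCos ρ = cos (3π (tpt ρ) / 2)`, which is concave with
critical point `tpt ρ`. On `[2/3, 1]` it is convex and vanishes at `1`, so it stays below its chord.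
The bound on `ρ` is `κ < 1`, that is `tpt ρ ≠ 0`, and yields `0 < lowerF ρ (tpt ρ)`.

*Existence.* The factor `1 / ∫ e^u` is a constant and can be absorbed into `λ`, which leaves the
local equation `u'' = -m p e^u`. After truncation of the exponent to `[-ρ, ρ]` the initial value
problem `u(0) = 0`, `u'(0) = a` has a solution on `[0,1]` that depends continuously on `(m, a)`
(`exists_shooting_family`, from the Picard–Lindelöf theorem). Let `m = ± ν` and let `v` be
`u - u(1) t`, which is `m` times the Green potential of `p e^u` (truncated). On a rectangle
`0 ≤ ν ≤ M`, `|a| ≤ A`, the number `u(1)` has the sign of `a` at `a = ± A`, while `‖v‖` is `0` at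
`ν = 0` and exceeds `ρ` at `ν = M`, because the potential at `tpt ρ` is at least
`e^ρ lowerF ρ (tpt ρ) > 0`. By the Poincaré–Miranda theorem in the plane
(`poincare_miranda_plane`) there is a point where `u(1) = 0` and `‖u‖ = ρ`; there the truncation is
not active, and `λ = m ∫ e^u`. The Poincaré–Miranda theorem itself is proved by lifting through the
covering `exp : ℂ → ℂ \ {0}`.
-/

/-! ### The Poincaré–Miranda theorem in the plane -/

/-- On an interval `S` where a continuous function never takes the values `α` and `β`, it cannot
leave the interval `(α, β)`. -/
lemma mem_Ioo_of_avoids_endpoints {S : Set ℝ} (hS : S.OrdConnected) {φ : ℝ → ℝ}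
    (hφ : Continuous φ) {α β : ℝ} (hα : ∀ x ∈ S, φ x ≠ α) (hβ : ∀ x ∈ S, φ x ≠ β) {x y : ℝ}
    (hx : x ∈ S) (hy : y ∈ S) (h : φ x ∈ Set.Ioo α β) : φ y ∈ Set.Ioo α β := by
  have hc : (φ '' S).OrdConnected :=
    ((isPreconnected_iff_ordConnected.mpr hS).image φ hφ.continuousOn).ordConnected
  have hxi : φ x ∈ φ '' S := ⟨x, hx, rfl⟩
  have hyi : φ y ∈ φ '' S := ⟨y, hy, rfl⟩
  constructor
  · by_contra! hlt
    obtain ⟨z, hz, hz'⟩ := hc.out hyi hxi ⟨hlt, h.1.le⟩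
    exact hα z hz hz'
  · by_contra! hlt
    obtain ⟨z, hz, hz'⟩ := hc.out hxi hyi ⟨h.2.le, hlt⟩
    exact hβ z hz hz'

/-- A continuous map from the plane to `ℂ` without zeros has a continuous logarithm; this is its
imaginary part, normalised to lie in `[-π, π]` at one point. -/
lemma exists_continuous_argument {F : ℝ × ℝ → ℂ} (hF : Continuous F) (h0 : ∀ p, F p ≠ 0)
    (p₀ : ℝ × ℝ) :
    ∃ θ : ℝ × ℝ → ℝ, Continuous θ ∧ θ p₀ ∈ Set.Icc (-Real.pi) Real.pi ∧
      ∀ p, ∃ r : ℝ, 0 < r ∧ (F p).re = r * Real.cos (θ p) ∧ (F p).im = r * Real.sin (θ p) := by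
  obtain ⟨G, ⟨hG0, hG⟩, -⟩ := Complex.isCoveringMapOn_exp.existsUnique_continuousMap_lifts
    (⟨F, hF⟩ : C(ℝ × ℝ, ℂ)) (a₀ := p₀) (e₀ := Complex.log (F p₀))
    (Complex.exp_log (h0 p₀)) (fun p => h0 p)
  refine ⟨fun p => (G p).im, by fun_prop, ?_, fun p => ⟨Real.exp (G p).re, Real.exp_pos _, ?_⟩⟩
  · simp only [hG0, Complex.log_im]
    exact ⟨(Complex.neg_pi_lt_arg _).le, Complex.arg_le_pi _⟩
  · have : F p = Complex.exp (G p) := (congrFun hG p).symm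
    rw [this]
    exact ⟨Complex.exp_re _, Complex.exp_im _⟩

/-- The Poincaré–Miranda theorem in the plane. Without a common zero, `g + i f` would have a
continuous argument on the rectangle; but the sign conditions force the argument to grow by `2π`
around the boundary. -/
theorem poincare_miranda_plane {f g : ℝ × ℝ → ℝ} {a b c d : ℝ} (hab : a ≤ b) (hcd : c ≤ d)
    (hf : ContinuousOn f (Set.Icc a b ×ˢ Set.Icc c d))
    (hg : ContinuousOn g (Set.Icc a b ×ˢ Set.Icc c d))
    (hleft : ∀ y ∈ Set.Icc c d, g (a, y) < 0) (hright : ∀ y ∈ Set.Icc c d, 0 < g (b, y))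
    (hbot : ∀ x ∈ Set.Icc a b, f (x, c) < 0) (htop : ∀ x ∈ Set.Icc a b, 0 < f (x, d)) :
    ∃ p ∈ Set.Icc a b ×ˢ Set.Icc c d, f p = 0 ∧ g p = 0 := by
  by_contra! hne
  -- extend to the whole plane along the nearest-point projection onto the rectangle
  set P : ℝ × ℝ → ℝ × ℝ := fun p => (Set.projIcc a b hab p.1, Set.projIcc c d hcd p.2) with hP
  have hPmem : ∀ p, P p ∈ Set.Icc a b ×ˢ Set.Icc c d := fun p =>
    ⟨(Set.projIcc a b hab p.1).2, (Set.projIcc c d hcd p.2).2⟩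
  have hPc : Continuous P := by
    have h1 : Continuous fun p : ℝ × ℝ => Set.projIcc a b hab p.1 :=
      continuous_projIcc.comp continuous_fst
    have h2 : Continuous fun p : ℝ × ℝ => Set.projIcc c d hcd p.2 :=
      continuous_projIcc.comp continuous_snd
    exact (continuous_subtype_val.comp h1).prodMk (continuous_subtype_val.comp h2)
  have hPid : ∀ x ∈ Set.Icc a b, ∀ y ∈ Set.Icc c d, P (x, y) = (x, y) := by
    intro x hx y hy
    simp only [hP, Set.projIcc_of_mem hab hx, Set.projIcc_of_mem hcd hy]
  have hfP : Continuous fun p => f (P p) := hf.comp_continuous hPc hPmem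
  have hgP : Continuous fun p => g (P p) := hg.comp_continuous hPc hPmem
  have hF : Continuous fun p => (⟨g (P p), f (P p)⟩ : ℂ) := by
    have : (fun p => (⟨g (P p), f (P p)⟩ : ℂ)) =
        fun p => ((g (P p) : ℝ) : ℂ) + ((f (P p) : ℝ) : ℂ) * Complex.I := by
      funext p; exact Complex.mk_eq_add_mul_I _ _
    rw [this]
    exact (Complex.continuous_ofReal.comp hgP).add
      ((Complex.continuous_ofReal.comp hfP).mul continuous_const)
  obtain ⟨θ, hθ, hθ0, hθF⟩ := exists_continuous_argument hF
    (fun p hp => hne (P p) (hPmem p) (congrArg Complex.im hp) (congrArg Complex.re hp)) (b, c)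
  have ha : a ∈ Set.Icc a b := ⟨le_rfl, hab⟩
  have hb : b ∈ Set.Icc a b := ⟨hab, le_rfl⟩
  have hc : c ∈ Set.Icc c d := ⟨le_rfl, hcd⟩
  have hd : d ∈ Set.Icc c d := ⟨hcd, le_rfl⟩
  have key : ∀ x ∈ Set.Icc a b, ∀ y ∈ Set.Icc c d, ∃ r : ℝ, 0 < r ∧
      g (x, y) = r * Real.cos (θ (x, y)) ∧ f (x, y) = r * Real.sin (θ (x, y)) := by
    intro x hx y hy
    have := hθF (x, y)
    rwa [hPid x hx y hy] at this
  have hR : ∀ y ∈ Set.Icc c d, 0 < Real.cos (θ (b, y)) := fun y hy => by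
    obtain ⟨r, hr, h1, -⟩ := key b hb y hy
    exact (pos_iff_pos_of_mul_pos (h1 ▸ hright y hy)).mp hr
  have hL : ∀ y ∈ Set.Icc c d, Real.cos (θ (a, y)) < 0 := fun y hy => by
    obtain ⟨r, hr, h1, -⟩ := key a ha y hy
    have := hleft y hy
    by_contra! h
    nlinarith [mul_nonneg hr.le h]
  have hT : ∀ x ∈ Set.Icc a b, 0 < Real.sin (θ (x, d)) := fun x hx => by
    obtain ⟨r, hr, -, h1⟩ := key x hx d hd
    exact (pos_iff_pos_of_mul_pos (h1 ▸ htop x hx)).mp hr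
  have hB : ∀ x ∈ Set.Icc a b, Real.sin (θ (x, c)) < 0 := fun x hx => by
    obtain ⟨r, hr, -, h1⟩ := key x hx c hc
    have := hbot x hx
    by_contra! h
    nlinarith [mul_nonneg hr.le h]
  have hπ := Real.pi_pos
  have hcosπ2 : Real.cos (3 * Real.pi / 2) = 0 := by
    rw [show 3 * Real.pi / 2 = Real.pi / 2 + Real.pi by ring, Real.cos_add_pi]; simp
  -- lower right corner
  have h1 : θ (b, c) ∈ Set.Ioo (-(Real.pi / 2)) (Real.pi / 2) := by
    constructor
    · by_contra! h
      have := Real.cos_nonpos_of_pi_div_two_le_of_le (x := -θ (b, c)) (by linarith)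
        (by linarith [hθ0.1])
      rw [Real.cos_neg] at this
      linarith [hR c hc]
    · by_contra! h
      have := Real.cos_nonpos_of_pi_div_two_le_of_le h (by linarith [hθ0.2])
      linarith [hR c hc]
  have h1' : θ (b, c) < 0 := by
    by_contra! h
    linarith [Real.sin_nonneg_of_nonneg_of_le_pi h hθ0.2, hB b hb]
  -- upper right corner
  have h2 : θ (b, d) ∈ Set.Ioo (-(Real.pi / 2)) (Real.pi / 2) := by
    refine mem_Ioo_of_avoids_endpoints (φ := fun y => θ (b, y)) Set.ordConnected_Icc
      (by fun_prop) (fun y hy h => ?_) (fun y hy h => ?_) hc hd h1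
    all_goals
      have := hR y hy
      rw [h] at this
      simp at this
  have h2' : 0 < θ (b, d) := by
    by_contra! h
    linarith [Real.sin_nonpos_of_nonpos_of_neg_pi_le h (by linarith [h2.1]), hT b hb]
  -- upper left corner
  have h3 : θ (a, d) ∈ Set.Ioo 0 Real.pi := by
    refine mem_Ioo_of_avoids_endpoints (φ := fun x => θ (x, d)) Set.ordConnected_Icc
      (by fun_prop) (fun y hy h => ?_) (fun y hy h => ?_) hb ha ⟨h2', by linarith [h2.2]⟩
    all_goals
      have := hT y hy
      rw [h] at this
      simp at this
  have h3' : Real.pi / 2 < θ (a, d) := by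
    by_contra! h
    linarith [Real.cos_nonneg_of_neg_pi_div_two_le_of_le (by linarith [h3.1]) h, hL d hd]
  -- lower left corner
  have h4 : θ (a, c) ∈ Set.Ioo (Real.pi / 2) (3 * Real.pi / 2) := by
    refine mem_Ioo_of_avoids_endpoints (φ := fun y => θ (a, y)) Set.ordConnected_Icc
      (by fun_prop) (fun y hy h => ?_) (fun y hy h => ?_) hd hc ⟨h3', by linarith [h3.2]⟩
    · have := hL y hy
      rw [h] at this
      simp at this
    · have := hL y hy
      rw [h, hcosπ2] at this
      exact lt_irrefl _ this
  have h4' : Real.pi < θ (a, c) := by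
    by_contra! h
    linarith [Real.sin_nonneg_of_nonneg_of_le_pi (by linarith [h4.1]) h, hB a ha]
  -- back at the lower right corner, where the argument was negative
  have h5 : θ (b, c) ∈ Set.Ioo Real.pi (2 * Real.pi) := by
    refine mem_Ioo_of_avoids_endpoints (φ := fun x => θ (x, c)) Set.ordConnected_Icc
      (by fun_prop) (fun y hy h => ?_) (fun y hy h => ?_) ha hb ⟨h4', by linarith [h4.2]⟩
    all_goals
      have := hB y hy
      rw [h] at this
      simp at this
  linarith [h5.1]

/-! ### The Green potential -/

/-- `(1 - t) ∫₀ᵗ s q(s) ds + t ∫ₜ¹ (1 - s) q(s) ds`, the Green potential of `q` with the kink of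
the kernel resolved. It makes sense, and is twice differentiable, on the whole line. -/
noncomputable def greenPotential (q : ℝ → ℝ) (t : ℝ) : ℝ :=
  (1 - t) * (∫ s in (0 : ℝ)..t, s * q s) + t * ∫ s in t..1, (1 - s) * q s

namespace DirichletExample

lemma green_nonneg {t s : ℝ} (ht : t ∈ Set.Icc (0 : ℝ) 1) (hs : s ∈ Set.Icc (0 : ℝ) 1) :
    0 ≤ green t s := by
  unfold green
  split_ifs
  · exact mul_nonneg ht.1 (by linarith [hs.2])
  · exact mul_nonneg hs.1 (by linarith [ht.2])

lemma green_eq_min_max (t s : ℝ) : green t s = min t s * (1 - max t s) := by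
  unfold green
  split_ifs with h
  · rw [min_eq_left h, max_eq_right h]
  · rw [min_eq_right (not_le.mp h).le, max_eq_left (not_le.mp h).le]

@[fun_prop]
lemma continuous_green (t : ℝ) : Continuous (green t) := by
  have : green t = fun s => min t s * (1 - max t s) := funext (green_eq_min_max t)
  rw [this]; fun_prop

lemma integral_green_of_le {q : ℝ → ℝ} {t a b : ℝ} (hab : a ≤ b) (h : t ≤ a) :
    ∫ s in a..b, green t s * q s = t * ∫ s in a..b, (1 - s) * q s := by
  rw [← intervalIntegral.integral_const_mul]
  refine intervalIntegral.integral_congr fun s hs => ?_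
  rw [Set.uIcc_of_le hab] at hs
  simp only [green, if_pos (h.trans hs.1)]
  ring

lemma integral_green_of_ge {q : ℝ → ℝ} {t a b : ℝ} (hab : a ≤ b) (h : b ≤ t) :
    ∫ s in a..b, green t s * q s = (1 - t) * ∫ s in a..b, s * q s := by
  rw [← intervalIntegral.integral_const_mul]
  refine intervalIntegral.integral_congr fun s hs => ?_
  rw [Set.uIcc_of_le hab] at hs
  have := hs.2.trans h
  simp only [green_eq_min_max, min_eq_right this, max_eq_left this]
  ring

lemma integral_green_of_mem {q : ℝ → ℝ} (hq : Continuous q) {t a b : ℝ}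
    (ht : t ∈ Set.Icc a b) :
    ∫ s in a..b, green t s * q s =
      (1 - t) * (∫ s in a..t, s * q s) + t * ∫ s in t..b, (1 - s) * q s := by
  rw [← integral_green_of_ge ht.1 le_rfl, ← integral_green_of_le ht.2 le_rfl]
  exact (intervalIntegral.integral_add_adjacent_intervals
    (Continuous.intervalIntegrable (by fun_prop) _ _)
    (Continuous.intervalIntegrable (by fun_prop) _ _)).symm

lemma integral_green_eq_greenPotential {q : ℝ → ℝ} (hq : Continuous q) {t : ℝ}
    (ht : t ∈ Set.Icc (0 : ℝ) 1) :
    ∫ s in (0 : ℝ)..1, green t s * q s = greenPotential q t :=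
  integral_green_of_mem hq ht

end DirichletExample

lemma greenPotential_zero (q : ℝ → ℝ) : greenPotential q 0 = 0 := by simp [greenPotential]

lemma greenPotential_one (q : ℝ → ℝ) : greenPotential q 1 = 0 := by simp [greenPotential]

lemma hasDerivAt_greenPotential {q : ℝ → ℝ} (hq : Continuous q) (t : ℝ) :
    HasDerivAt (greenPotential q)
      (-(∫ s in (0 : ℝ)..t, s * q s) + ∫ s in t..1, (1 - s) * q s) t := by
  have h1 : HasDerivAt (fun t => ∫ s in (0 : ℝ)..t, s * q s) (t * q t) t :=
    intervalIntegral.integral_hasDerivAt_right (Continuous.intervalIntegrable (by fun_prop) _ _)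
      (Continuous.stronglyMeasurableAtFilter (by fun_prop) _ _)
      (Continuous.continuousAt (by fun_prop))
  have h2 : HasDerivAt (fun t => ∫ s in t..1, (1 - s) * q s) (-((1 - t) * q t)) t :=
    intervalIntegral.integral_hasDerivAt_left (Continuous.intervalIntegrable (by fun_prop) _ _)
      (Continuous.stronglyMeasurableAtFilter (by fun_prop) _ _)
      (Continuous.continuousAt (by fun_prop))
  convert! (((hasDerivAt_id t).const_sub 1).mul h1).add ((hasDerivAt_id t).mul h2) using 1
  simp only [id]
  ring

lemma hasDerivAt_deriv_greenPotential {q : ℝ → ℝ} (hq : Continuous q) (t : ℝ) :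
    HasDerivAt (deriv (greenPotential q)) (-q t) t := by
  have h1 : HasDerivAt (fun t => ∫ s in (0 : ℝ)..t, s * q s) (t * q t) t :=
    intervalIntegral.integral_hasDerivAt_right (Continuous.intervalIntegrable (by fun_prop) _ _)
      (Continuous.stronglyMeasurableAtFilter (by fun_prop) _ _)
      (Continuous.continuousAt (by fun_prop))
  have h2 : HasDerivAt (fun t => ∫ s in t..1, (1 - s) * q s) (-((1 - t) * q t)) t :=
    intervalIntegral.integral_hasDerivAt_left (Continuous.intervalIntegrable (by fun_prop) _ _)
      (Continuous.stronglyMeasurableAtFilter (by fun_prop) _ _)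
      (Continuous.continuousAt (by fun_prop))
  have hd : deriv (greenPotential q) =
      fun t => -(∫ s in (0 : ℝ)..t, s * q s) + ∫ s in t..1, (1 - s) * q s :=
    funext fun t => (hasDerivAt_greenPotential hq t).deriv
  rw [hd]
  convert! h1.neg.add h2 using 1
  ring

lemma continuous_greenPotential {q : ℝ → ℝ} (hq : Continuous q) :
    Continuous (greenPotential q) :=
  continuous_iff_continuousAt.mpr fun t => (hasDerivAt_greenPotential hq t).continuousAt

/-- A function that is continuous on `[0,1]` with `w'' = 0` inside and `w(0) = w(1) = 0` vanishes
on `[0,1]`. The first derivative is given as `z`. -/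
lemma eq_zero_of_deriv_deriv_eq_zero {w z : ℝ → ℝ} (hw : ContinuousOn w (Set.Icc 0 1))
    (h1 : ∀ t ∈ Set.Ioo (0 : ℝ) 1, HasDerivAt w (z t) t)
    (h2 : ∀ t ∈ Set.Ioo (0 : ℝ) 1, HasDerivAt z 0 t) (hw0 : w 0 = 0) (hw1 : w 1 = 0) :
    ∀ t ∈ Set.Icc (0 : ℝ) 1, w t = 0 := by
  have hz : ∀ t ∈ Set.Ioo (0 : ℝ) 1, z t = z (1 / 2) := fun t ht =>
    isOpen_Ioo.is_const_of_deriv_eq_zero isPreconnected_Ioo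
      (fun x hx => (h2 x hx).differentiableAt.differentiableWithinAt)
      (fun x hx => (h2 x hx).deriv) ht (by norm_num)
  have hlin : ∀ t ∈ Set.Icc (0 : ℝ) 1, w t - z (1 / 2) * t = w 0 - z (1 / 2) * 0 := by
    intro t ht
    rcases ht.1.eq_or_lt with h | h
    · rw [← h]
    obtain ⟨c, hc, hc'⟩ := exists_hasDerivAt_eq_slope (fun x => w x - z (1 / 2) * x)
      (fun x => z x - z (1 / 2)) h
      ((hw.mono (Set.Icc_subset_Icc_right ht.2)).sub (by fun_prop))
      (fun x hx => by
        simpa using (h1 x ⟨hx.1, hx.2.trans_le ht.2⟩).fun_sub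
          ((hasDerivAt_id x).const_mul (z (1 / 2))))
    rw [hz c ⟨hc.1, hc.2.trans_le ht.2⟩, sub_self, eq_comm, div_eq_zero_iff] at hc'
    rcases hc' with hc' | hc' <;> linarith
  intro t ht
  have h0 := hlin t ht
  have h1' := hlin 1 (by norm_num)
  rw [hw0] at h0 h1'
  rw [hw1] at h1'
  have : z (1 / 2) = 0 := by linarith
  rw [this] at h0
  linarith

/-- The Dirichlet problem `-w'' = q`, `w(0) = w(1) = 0` has no solution but the Green potential. -/
lemma eq_greenPotential {q w z : ℝ → ℝ} (hq : Continuous q)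
    (hw : ContinuousOn w (Set.Icc 0 1))
    (h1 : ∀ t ∈ Set.Ioo (0 : ℝ) 1, HasDerivAt w (z t) t)
    (h2 : ∀ t ∈ Set.Ioo (0 : ℝ) 1, HasDerivAt z (-q t) t) (hw0 : w 0 = 0) (hw1 : w 1 = 0)
    {t : ℝ} (ht : t ∈ Set.Icc (0 : ℝ) 1) : w t = greenPotential q t := by
  refine sub_eq_zero.mp (eq_zero_of_deriv_deriv_eq_zero
    (w := fun t => w t - greenPotential q t) (z := fun t => z t - deriv (greenPotential q) t)
    (hw.sub (continuous_greenPotential hq).continuousOn) (fun t ht => ?_) (fun t ht => ?_)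
    ?_ ?_ t ht)
  · exact (h1 t ht).sub (hasDerivAt_greenPotential hq t).differentiableAt.hasDerivAt
  · simpa using (h2 t ht).fun_sub (hasDerivAt_deriv_greenPotential hq t)
  · simp [hw0, greenPotential_zero]
  · simp [hw1, greenPotential_one]

/-! ### The lower bound function and its maximum -/

lemma integral_mul_sin_mul {ω : ℝ} (hω : ω ≠ 0) (a b : ℝ) :
    ∫ s in a..b, s * Real.sin (ω * s) =
      (Real.sin (ω * b) / ω ^ 2 - b * Real.cos (ω * b) / ω) -
        (Real.sin (ω * a) / ω ^ 2 - a * Real.cos (ω * a) / ω) := by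
  refine intervalIntegral.integral_eq_sub_of_hasDerivAt
    (f := fun s => Real.sin (ω * s) / ω ^ 2 - s * Real.cos (ω * s) / ω) (fun s _ => ?_)
    (Continuous.intervalIntegrable (by fun_prop) _ _)
  have h := (hasDerivAt_id s).const_mul ω
  convert! (h.sin.div_const (ω ^ 2)).fun_sub (((hasDerivAt_id s).mul h.cos).div_const ω) using 1
  simp only [id]
  field_simp
  ring

lemma integral_one_sub_mul_sin_mul {ω : ℝ} (hω : ω ≠ 0) (a b : ℝ) :
    ∫ s in a..b, (1 - s) * Real.sin (ω * s) =
      ((1 - a) * Real.cos (ω * a) / ω + Real.sin (ω * a) / ω ^ 2) -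
        ((1 - b) * Real.cos (ω * b) / ω + Real.sin (ω * b) / ω ^ 2) := by
  rw [intervalIntegral.integral_eq_sub_of_hasDerivAt
    (f := fun s => -((1 - s) * Real.cos (ω * s) / ω + Real.sin (ω * s) / ω ^ 2)) (fun s _ => ?_)
    (Continuous.intervalIntegrable (by fun_prop) _ _)]
  · ring
  have h := (hasDerivAt_id s).const_mul ω
  convert! (((((hasDerivAt_id s).const_sub 1).mul h.cos).div_const ω).fun_add
    (h.sin.div_const (ω ^ 2))).fun_neg using 1
  simp only [id]
  field_simp
  ring

/-- The sine is strictly concave on `[0, π]`, hence below its tangents. -/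
lemma sin_lt_tangent {x x₀ : ℝ} (hx : x ∈ Set.Icc 0 Real.pi) (hx₀ : x₀ ∈ Set.Icc 0 Real.pi)
    (hne : x ≠ x₀) : Real.sin x < Real.sin x₀ + Real.cos x₀ * (x - x₀) := by
  rcases hne.lt_or_gt with h | h
  · obtain ⟨c, hc, hc'⟩ := exists_hasDerivAt_eq_slope Real.sin Real.cos h
      Real.continuous_sin.continuousOn (fun y _ => Real.hasDerivAt_sin y)
    have hlt := Real.cos_lt_cos_of_nonneg_of_le_pi (hx.1.trans hc.1.le) hx₀.2 hc.2
    rw [hc', lt_div_iff₀ (by linarith)] at hlt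
    linarith
  · obtain ⟨c, hc, hc'⟩ := exists_hasDerivAt_eq_slope Real.sin Real.cos h
      Real.continuous_sin.continuousOn (fun y _ => Real.hasDerivAt_sin y)
    have hlt := Real.cos_lt_cos_of_nonneg_of_le_pi hx₀.1 (hc.2.le.trans hx.2) hc.1
    rw [hc', div_lt_iff₀ (by linarith)] at hlt
    linarith

namespace DirichletExample

lemma sin_weight_nonneg {s : ℝ} (hs : s ∈ Set.Icc (0 : ℝ) (2 / 3)) :
    0 ≤ Real.sin (3 / 2 * Real.pi * s) := by
  have hπ := Real.pi_pos
  refine Real.sin_nonneg_of_nonneg_of_le_pi (by have := hs.1; positivity) ?_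
  nlinarith [hs.2]

lemma sin_weight_le {s : ℝ} (hs : s ∈ Set.Icc (2 / 3 : ℝ) 1) :
    Real.sin (3 / 2 * Real.pi * s) ≤ 2 - 3 * s := by
  have hπ := Real.pi_pos
  -- Jordan's inequality after a shift by half a period
  have h := Real.mul_le_sin (x := 3 / 2 * Real.pi * s - Real.pi) (by nlinarith [hs.1])
    (by nlinarith [hs.2])
  rw [Real.sin_sub_pi] at h
  have h2 : 2 / Real.pi * (3 / 2 * Real.pi * s - Real.pi) = 3 * s - 2 := by field_simp
  linarith

lemma sin_weight_nonpos {s : ℝ} (hs : s ∈ Set.Icc (2 / 3 : ℝ) 1) :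
    Real.sin (3 / 2 * Real.pi * s) ≤ 0 := by
  linarith [sin_weight_le hs, hs.1]

/-- A factor `w` with values in `[lo, hi]` is at worst `lo` where the sine is positive and `hi`
where it is negative. -/
lemma weighted_integral_green_ge {w : ℝ → ℝ} (hw : Continuous w) {lo hi : ℝ}
    (hwb : ∀ s ∈ Set.Icc (0 : ℝ) 1, w s ∈ Set.Icc lo hi) {t : ℝ} (ht : t ∈ Set.Icc (0 : ℝ) 1) :
    lo * (∫ s in (0 : ℝ)..(2 / 3), green t s * Real.sin (3 / 2 * Real.pi * s)) +
      hi * (∫ s in (2 / 3 : ℝ)..1, green t s * Real.sin (3 / 2 * Real.pi * s)) ≤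
    ∫ s in (0 : ℝ)..1, green t s * (Real.sin (3 / 2 * Real.pi * s) * w s) := by
  rw [← intervalIntegral.integral_add_adjacent_intervals (a := 0) (b := 2 / 3) (c := 1)
    (f := fun s => green t s * (Real.sin (3 / 2 * Real.pi * s) * w s))
    (Continuous.intervalIntegrable (by fun_prop) _ _)
    (Continuous.intervalIntegrable (by fun_prop) _ _),
    ← intervalIntegral.integral_const_mul, ← intervalIntegral.integral_const_mul]
  refine add_le_add ?_ ?_
  · refine intervalIntegral.integral_mono_on (by norm_num)
      (Continuous.intervalIntegrable (by fun_prop) _ _)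
      (Continuous.intervalIntegrable (by fun_prop) _ _) fun s hs => ?_
    have hs1 : s ∈ Set.Icc (0 : ℝ) 1 := ⟨hs.1, by linarith [hs.2]⟩
    have := mul_nonneg (green_nonneg ht hs1) (sin_weight_nonneg hs)
    nlinarith [mul_le_mul_of_nonneg_left (hwb s hs1).1 this]
  · refine intervalIntegral.integral_mono_on (by norm_num)
      (Continuous.intervalIntegrable (by fun_prop) _ _)
      (Continuous.intervalIntegrable (by fun_prop) _ _) fun s hs => ?_
    have hs1 : s ∈ Set.Icc (0 : ℝ) 1 := ⟨by linarith [hs.1], hs.2⟩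
    have := mul_nonpos_of_nonneg_of_nonpos (green_nonneg ht hs1) (sin_weight_nonpos hs)
    nlinarith [mul_le_mul_of_nonpos_left (hwb s hs1).2 this]

lemma cos_three_halves_pi : Real.cos (3 / 2 * Real.pi * 1) = 0 := by
  rw [show 3 / 2 * Real.pi * 1 = Real.pi / 2 + Real.pi by ring, Real.cos_add_pi]; simp

lemma sin_three_halves_pi : Real.sin (3 / 2 * Real.pi * 1) = -1 := by
  rw [show 3 / 2 * Real.pi * 1 = Real.pi / 2 + Real.pi by ring, Real.sin_add_pi]; simp

lemma lowerF_eq_of_le (ρ : ℝ) {t : ℝ} (ht : t ∈ Set.Icc (0 : ℝ) (2 / 3)) :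
    lowerF ρ t =
      Real.exp (-2 * ρ) * (Real.sin (3 / 2 * Real.pi * t) / (3 / 2 * Real.pi) ^ 2 +
        t / (3 * (3 / 2 * Real.pi))) +
      Real.exp (2 * ρ) * (t * (1 / (3 / 2 * Real.pi) ^ 2 - 1 / (3 * (3 / 2 * Real.pi)))) := by
  have hω : 3 / 2 * Real.pi ≠ 0 := by positivity
  have hπ : 3 / 2 * Real.pi * (2 / 3) = Real.pi := by ring
  rw [lowerF, integral_green_of_mem (by fun_prop) ht, integral_green_of_le (by norm_num) ht.2,
    integral_mul_sin_mul hω, integral_one_sub_mul_sin_mul hω, integral_one_sub_mul_sin_mul hω,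
    hπ, Real.sin_pi, Real.cos_pi, cos_three_halves_pi, sin_three_halves_pi]
  simp only [mul_zero, Real.sin_zero]
  generalize 3 / 2 * Real.pi = ω at *
  field_simp
  ring

lemma lowerF_eq_of_ge (ρ : ℝ) {t : ℝ} (ht : t ∈ Set.Icc (2 / 3 : ℝ) 1) :
    lowerF ρ t =
      Real.exp (-2 * ρ) * ((1 - t) * (2 / (3 * (3 / 2 * Real.pi)))) +
      Real.exp (2 * ρ) * (Real.sin (3 / 2 * Real.pi * t) / (3 / 2 * Real.pi) ^ 2 -
        (1 - t) * (2 / (3 * (3 / 2 * Real.pi))) + t / (3 / 2 * Real.pi) ^ 2) := by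
  have hω : 3 / 2 * Real.pi ≠ 0 := by positivity
  have hπ : 3 / 2 * Real.pi * (2 / 3) = Real.pi := by ring
  rw [lowerF, integral_green_of_ge (by norm_num) ht.1, integral_green_of_mem (by fun_prop) ht,
    integral_mul_sin_mul hω, integral_mul_sin_mul hω, integral_one_sub_mul_sin_mul hω,
    hπ, Real.sin_pi, Real.cos_pi, cos_three_halves_pi, sin_three_halves_pi]
  simp only [mul_zero, Real.sin_zero]
  generalize 3 / 2 * Real.pi = ω at *
  field_simp
  ring

/-- On the part of `[0,1]` where the sine is negative, `lowerF ρ` is convex and vanishes at `1`, so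
it lies below its chord. -/
lemma lowerF_le_chord (ρ : ℝ) {t : ℝ} (ht : t ∈ Set.Icc (2 / 3 : ℝ) 1) :
    lowerF ρ t ≤ 3 * (1 - t) * lowerF ρ (2 / 3) := by
  have hω : 0 < 3 / 2 * Real.pi := by positivity
  have hπ : 3 / 2 * Real.pi * (2 / 3) = Real.pi := by ring
  have hs := sin_weight_le ht
  rw [lowerF_eq_of_ge ρ ht, lowerF_eq_of_le ρ (t := 2 / 3) (by norm_num), hπ, Real.sin_pi]
  have hE := Real.exp_pos (2 * ρ)
  generalize Real.exp (2 * ρ) = E at *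
  generalize Real.sin (3 / 2 * Real.pi * t) = S at *
  generalize 3 / 2 * Real.pi = ω at *
  have : 0 ≤ E * ((2 - 3 * t - S) / ω ^ 2) :=
    mul_nonneg hE.le (div_nonneg (by linarith) (by positivity))
  refine sub_nonneg.mp (this.trans_eq ?_)
  field_simp
  ring

/-- The argument of the arccosine in `tpt`, the cosine of the angle at which `lowerF ρ` is
critical. -/
noncomputable def critCos (ρ : ℝ) : ℝ := Real.exp (4 * ρ) * ((Real.pi - 2) / (3 * Real.pi)) - 1 / 3

lemma neg_one_lt_critCos (ρ : ℝ) : -1 < critCos ρ := by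
  have h2 : 0 < (Real.pi - 2) / (3 * Real.pi) :=
    div_pos (by linarith [Real.pi_gt_three]) (by positivity)
  have := mul_pos (Real.exp_pos (4 * ρ)) h2
  unfold critCos
  linarith

/-- The upper bound on `ρ` is equivalent to this inequality. -/
lemma critCos_lt_one {ρ : ℝ}
    (hρ : ρ < Real.log ((4 * Real.pi / (Real.pi - 2)) ^ (1 / 4 : ℝ))) : critCos ρ < 1 := by
  have hπ := Real.pi_pos
  have h2 : 0 < Real.pi - 2 := by linarith [Real.pi_gt_three]
  rw [Real.log_rpow (by positivity)] at hρ
  have h4 : Real.exp (4 * ρ) < 4 * Real.pi / (Real.pi - 2) := by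
    rw [← Real.lt_log_iff_exp_lt (by positivity)]
    linarith
  have h5 := mul_lt_mul_of_pos_right h4 (div_pos h2 (by positivity : 0 < 3 * Real.pi))
  have h6 : 4 * Real.pi / (Real.pi - 2) * ((Real.pi - 2) / (3 * Real.pi)) = 4 / 3 := by
    field_simp
  unfold critCos
  linarith

lemma lowerF_eq_critCos (ρ : ℝ) {t : ℝ} (ht : t ∈ Set.Icc (0 : ℝ) (2 / 3)) :
    lowerF ρ t = Real.exp (-2 * ρ) / (3 / 2 * Real.pi) ^ 2 *
      (Real.sin (3 / 2 * Real.pi * t) - critCos ρ * (3 / 2 * Real.pi * t)) := by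
  have hE : Real.exp (2 * ρ) = Real.exp (-2 * ρ) * Real.exp (4 * ρ) := by
    rw [← Real.exp_add]; ring_nf
  rw [lowerF_eq_of_le ρ ht, hE, critCos]
  field_simp
  ring

lemma angle_tpt (ρ : ℝ) : 3 / 2 * Real.pi * tpt ρ = Real.arccos (critCos ρ) := by
  rw [tpt, critCos]
  field_simp

lemma tpt_mem (ρ : ℝ) : tpt ρ ∈ Set.Icc (0 : ℝ) (2 / 3) := by
  have hπ := Real.pi_pos
  have h := angle_tpt ρ
  have h0 := Real.arccos_nonneg (critCos ρ)
  have h1 := Real.arccos_le_pi (critCos ρ)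
  constructor <;> nlinarith

lemma tpt_mem_Icc (ρ : ℝ) : tpt ρ ∈ Set.Icc (0 : ℝ) 1 :=
  ⟨(tpt_mem ρ).1, (tpt_mem ρ).2.trans (by norm_num)⟩

lemma cos_angle_tpt {ρ : ℝ}
    (hρ : ρ < Real.log ((4 * Real.pi / (Real.pi - 2)) ^ (1 / 4 : ℝ))) :
    Real.cos (3 / 2 * Real.pi * tpt ρ) = critCos ρ := by
  rw [angle_tpt, Real.cos_arccos (neg_one_lt_critCos ρ).le (critCos_lt_one hρ).le]

lemma angle_mem {t : ℝ} (ht : t ∈ Set.Icc (0 : ℝ) (2 / 3)) :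
    3 / 2 * Real.pi * t ∈ Set.Icc 0 Real.pi := by
  have hπ := Real.pi_pos
  constructor <;> nlinarith [ht.1, ht.2]

/-- On `[0, 2/3]`, where `lowerF ρ` is strictly concave, `tpt ρ` is its critical point. -/
lemma lowerF_lt_lowerF_tpt {ρ : ℝ}
    (hρ : ρ < Real.log ((4 * Real.pi / (Real.pi - 2)) ^ (1 / 4 : ℝ))) {t : ℝ}
    (ht : t ∈ Set.Icc (0 : ℝ) (2 / 3)) (hne : t ≠ tpt ρ) :
    lowerF ρ t < lowerF ρ (tpt ρ) := by
  have hω : 0 < 3 / 2 * Real.pi := by positivity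
  rw [lowerF_eq_critCos ρ ht, lowerF_eq_critCos ρ (tpt_mem ρ)]
  refine mul_lt_mul_of_pos_left ?_ (by positivity)
  have h := sin_lt_tangent (angle_mem ht) (angle_mem (tpt_mem ρ))
    (fun h => hne (mul_left_cancel₀ hω.ne' h))
  rw [cos_angle_tpt hρ] at h
  linarith

/-- The upper bound on `ρ` says that `tpt ρ` is not `0`, where `lowerF ρ` vanishes. -/
lemma lowerF_tpt_pos {ρ : ℝ}
    (hρ : ρ < Real.log ((4 * Real.pi / (Real.pi - 2)) ^ (1 / 4 : ℝ))) :
    0 < lowerF ρ (tpt ρ) := by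
  have h0 : lowerF ρ 0 = 0 := by rw [lowerF_eq_critCos ρ (by norm_num)]; simp
  refine h0 ▸ lowerF_lt_lowerF_tpt hρ (by norm_num) fun h => ?_
  have := cos_angle_tpt hρ
  rw [← h, mul_zero, Real.cos_zero] at this
  linarith [critCos_lt_one hρ]

lemma isMaxOn_lowerF {ρ : ℝ}
    (hρ : ρ < Real.log ((4 * Real.pi / (Real.pi - 2)) ^ (1 / 4 : ℝ))) :
    IsMaxOn (lowerF ρ) (Set.Icc (0 : ℝ) 1) (tpt ρ) := by
  have hle : ∀ t ∈ Set.Icc (0 : ℝ) (2 / 3), lowerF ρ t ≤ lowerF ρ (tpt ρ) := fun t ht => by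
    by_cases h : t = tpt ρ
    · rw [h]
    · exact (lowerF_lt_lowerF_tpt hρ ht h).le
  intro t ht
  change lowerF ρ t ≤ lowerF ρ (tpt ρ)
  rcases le_total t (2 / 3) with h | h
  · exact hle t ⟨ht.1, h⟩
  · have h1 := lowerF_le_chord ρ ⟨h, ht.2⟩
    have h2 := hle (2 / 3) (by norm_num)
    have h3 := lowerF_tpt_pos hρ
    have h4 : 3 * (1 - t) * lowerF ρ (2 / 3) ≤ 3 * (1 - t) * lowerF ρ (tpt ρ) :=
      mul_le_mul_of_nonneg_left h2 (by linarith [ht.2])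
    nlinarith

end DirichletExample

/-! ### The shooting family -/

/-- The truncation of a real number to `[-V, V]`. -/
noncomputable def clamp (V x : ℝ) : ℝ := max (-V) (min x V)

lemma lipschitzWith_clamp (V : ℝ) : LipschitzWith 1 (clamp V) :=
  (LipschitzWith.id.min_const V).const_max (-V)

@[fun_prop]
lemma continuous_clamp (V : ℝ) : Continuous (clamp V) := (lipschitzWith_clamp V).continuous

lemma clamp_mem {V : ℝ} (hV : 0 ≤ V) (x : ℝ) : clamp V x ∈ Set.Icc (-V) V :=
  ⟨le_max_left _ _, max_le (by linarith) (min_le_right _ _)⟩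

lemma abs_clamp_le {V : ℝ} (hV : 0 ≤ V) (x : ℝ) : |clamp V x| ≤ V := abs_le.mpr (clamp_mem hV x)

lemma clamp_of_abs_le {V x : ℝ} (h : |x| ≤ V) : clamp V x = x := by
  obtain ⟨h1, h2⟩ := abs_le.mp h
  rw [clamp, min_eq_left h2, max_eq_right h1]

lemma abs_exp_clamp_sub_le {ρ : ℝ} (hρ : 0 ≤ ρ) (x y : ℝ) :
    |Real.exp (clamp ρ x) - Real.exp (clamp ρ y)| ≤ Real.exp ρ * |x - y| := by
  have h := (convex_Icc (-ρ) ρ).norm_image_sub_le_of_norm_deriv_le (f := Real.exp)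
    (C := Real.exp ρ) (fun x _ => Real.differentiableAt_exp)
    (fun x hx => by
      rw [Real.deriv_exp, Real.norm_eq_abs, Real.abs_exp]
      exact Real.exp_le_exp.mpr hx.2) (clamp_mem hρ y) (clamp_mem hρ x)
  refine h.trans (mul_le_mul_of_nonneg_left ?_ (Real.exp_pos _).le)
  simpa [Real.dist_eq] using (lipschitzWith_clamp ρ).dist_le_mul x y

/-- The vector field of the shooting problem on triples `(u, u', m)`, for the equation
`u'' = -m p(t) g(u)` with constant `m`. The velocity and the parameter are truncated, which makes
the field bounded. -/
noncomputable def shootingField (V M : ℝ) (p g : ℝ → ℝ) (t : ℝ) (x : ℝ × ℝ × ℝ) : ℝ × ℝ × ℝ :=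
  (clamp V x.2.1, -(clamp M x.2.2 * (p t * g x.1)), 0)

lemma abs_shootingField_snd_le {V M B : ℝ} (hM : 0 ≤ M) {p g : ℝ → ℝ}
    (hp : ∀ t, |p t| ≤ 1) (hg : ∀ x, |g x| ≤ B) (t : ℝ) (x : ℝ × ℝ × ℝ) :
    |(shootingField V M p g t x).2.1| ≤ M * B := by
  simp only [shootingField, abs_neg, abs_mul]
  have := mul_le_mul (hp t) (hg x.1) (abs_nonneg _) zero_le_one
  rw [one_mul] at this
  exact mul_le_mul (abs_clamp_le hM _) this (by positivity) hM

lemma norm_shootingField_le {V M B : ℝ} (hV : 0 ≤ V) (hM : 0 ≤ M) {p g : ℝ → ℝ}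
    (hp : ∀ t, |p t| ≤ 1) (hg : ∀ x, |g x| ≤ B) (t : ℝ) (x : ℝ × ℝ × ℝ) :
    ‖shootingField V M p g t x‖ ≤ V + M * B := by
  have h2 := abs_shootingField_snd_le (V := V) hM hp hg t x
  have h3 : 0 ≤ M * B := (abs_nonneg _).trans h2
  have h1 := abs_clamp_le hV x.2.1
  simp only [Prod.norm_def, Real.norm_eq_abs]
  refine max_le ?_ (max_le (by linarith) ?_)
  · simp only [shootingField]
    linarith
  · simp only [shootingField, abs_zero]
    linarith

lemma lipschitzWith_shootingField {V M B K : ℝ} (hM : 0 ≤ M) (hK : 0 ≤ K)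
    {p g : ℝ → ℝ} (hp : ∀ t, |p t| ≤ 1) (hg : ∀ x, |g x| ≤ B)
    (hgL : ∀ x y, |g x - g y| ≤ K * |x - y|) (t : ℝ) :
    LipschitzWith (1 + B + M * K).toNNReal (shootingField V M p g t) := by
  have hB : 0 ≤ B := (abs_nonneg _).trans (hg 0)
  refine LipschitzWith.of_dist_le_mul fun x y => ?_
  rw [Real.coe_toNNReal _ (by positivity)]
  have hd : ∀ {i : ℝ}, i ≤ dist x y → 0 ≤ dist x y → i ≤ (1 + B + M * K) * dist x y := by
    intro i hi h0
    nlinarith [mul_nonneg (by positivity : 0 ≤ B + M * K) h0]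
  have hd0 : 0 ≤ dist x y := dist_nonneg
  have hx1 : |x.1 - y.1| ≤ dist x y := by
    rw [← Real.dist_eq, Prod.dist_eq]; exact le_max_left _ _
  have hx2 : |x.2.1 - y.2.1| ≤ dist x y := by
    rw [← Real.dist_eq, Prod.dist_eq, Prod.dist_eq (x := x.2)]
    exact (le_max_left _ _).trans (le_max_right _ _)
  have hx3 : |x.2.2 - y.2.2| ≤ dist x y := by
    rw [← Real.dist_eq, Prod.dist_eq, Prod.dist_eq (x := x.2)]
    exact (le_max_right _ _).trans (le_max_right _ _)
  have hcl : ∀ W a b : ℝ, |clamp W a - clamp W b| ≤ |a - b| := fun W a b => by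
    simpa [Real.dist_eq] using (lipschitzWith_clamp W).dist_le_mul a b
  have key : |clamp M x.2.2 * (p t * g x.1) - clamp M y.2.2 * (p t * g y.1)| ≤
      (B + M * K) * dist x y := by
    have hsplit : clamp M x.2.2 * (p t * g x.1) - clamp M y.2.2 * (p t * g y.1) =
        p t * ((clamp M x.2.2 - clamp M y.2.2) * g x.1 + clamp M y.2.2 * (g x.1 - g y.1)) := by
      ring
    rw [hsplit, abs_mul]
    refine (mul_le_of_le_one_left (abs_nonneg _) (hp t)).trans ((abs_add_le _ _).trans ?_)
    rw [abs_mul, abs_mul]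
    have e1 : |clamp M x.2.2 - clamp M y.2.2| * |g x.1| ≤ dist x y * B :=
      mul_le_mul ((hcl _ _ _).trans hx3) (hg _) (abs_nonneg _) hd0
    have e2 : |clamp M y.2.2| * |g x.1 - g y.1| ≤ M * (K * dist x y) :=
      mul_le_mul (abs_clamp_le hM _)
        ((hgL _ _).trans (mul_le_mul_of_nonneg_left hx1 hK)) (abs_nonneg _) hM
    linarith
  rw [Prod.dist_eq, Prod.dist_eq]
  refine max_le ?_ (max_le ?_ ?_)
  · simp only [shootingField, Real.dist_eq]
    exact hd ((hcl _ _ _).trans hx2) hd0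
  · simp only [shootingField, dist_neg_neg, Real.dist_eq]
    linarith
  · simp only [shootingField, dist_self]
    positivity

namespace DirichletExample

lemma continuous_ext (u : C(unitInterval, ℝ)) : Continuous (ext u) :=
  u.continuous.Icc_extend'

lemma ext_of_mem (u : C(unitInterval, ℝ)) {t : ℝ} (ht : t ∈ Set.Icc (0 : ℝ) 1) :
    ext u t = u ⟨t, ht⟩ := Set.IccExtend_of_mem _ _ ht

/-- The solutions of `u'' = -m p(t) g(u)`, `u(0) = 0`, `u'(0) = a` on `[0,1]`, as a family in
`C([0,1])` that is continuous in `(m, a)`; the derivative of `u` is given as `z`. -/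
lemma exists_shooting_family {M A B K : ℝ} (hM : 0 ≤ M) (hA : 0 ≤ A) (hK : 0 ≤ K) {p g : ℝ → ℝ}
    (hpc : Continuous p) (hp : ∀ t, |p t| ≤ 1) (hg : ∀ x, |g x| ≤ B)
    (hgL : ∀ x y, |g x - g y| ≤ K * |x - y|) :
    ∃ u : ℝ × ℝ → C(unitInterval, ℝ), Continuous u ∧
      ∀ m ∈ Set.Icc (-M) M, ∀ a ∈ Set.Icc (-A) A, u (m, a) 0 = 0 ∧ ∃ z : ℝ → ℝ,
        (∀ t ∈ Set.Icc (0 : ℝ) 1, |z t - a| ≤ M * B) ∧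
        ∀ t ∈ Set.Ioo (0 : ℝ) 1, HasDerivAt (ext (u (m, a))) (z t) t ∧
          HasDerivAt z (-(m * (p t * g (ext (u (m, a)) t)))) t := by
  have hB : 0 ≤ B := (abs_nonneg _).trans (hg 0)
  have hMB : 0 ≤ M * B := by positivity
  -- an a priori bound for the velocity, so that its truncation is never active
  set V : ℝ := A + M * B with hV
  have hV0 : 0 ≤ V := by positivity
  set r : NNReal := (A + M).toNNReal with hr
  set L : NNReal := (V + M * B).toNNReal with hL
  have hLc : (L : ℝ) = V + M * B := Real.coe_toNNReal _ (by positivity)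
  have hrc : (r : ℝ) = A + M := Real.coe_toNNReal _ (by positivity)
  have hPL : IsPicardLindelof (shootingField V M p g) (⟨0, by norm_num⟩ : Set.Icc (0 : ℝ) 1)
      (0 : ℝ × ℝ × ℝ) (r + L) r L (1 + B + M * K).toNNReal := by
    refine ⟨fun t _ => (lipschitzWith_shootingField hM hK hp hg hgL t).lipschitzOnWith,
      fun x _ => ?_, fun t _ x _ => ?_, ?_⟩
    · unfold shootingField; fun_prop
    · rw [hLc]; exact norm_shootingField_le hV0 hM hp hg t x
    · simp
  obtain ⟨α, hα, hαc⟩ := hPL.exists_forall_mem_closedBall_eq_hasDerivWithinAt_continuousOn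
  have hball : ∀ m ∈ Set.Icc (-M) M, ∀ a ∈ Set.Icc (-A) A,
      ((0, a, m) : ℝ × ℝ × ℝ) ∈ Metric.closedBall (0 : ℝ × ℝ × ℝ) r := by
    intro m hm a ha
    have h1 := abs_le.mpr hm
    have h2 := abs_le.mpr ha
    rw [mem_closedBall_zero_iff, hrc]
    simp only [Prod.norm_mk, Real.norm_eq_abs, abs_zero]
    exact max_le (by positivity) (max_le (by linarith) (by linarith))
  have hcont : Continuous fun x : (ℝ × ℝ) × unitInterval =>
      (α ((0, clamp A x.1.2, clamp M x.1.1), (x.2 : ℝ))).1 := by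
    refine continuous_fst.comp (hαc.comp_continuous (by fun_prop) fun x => ?_)
    exact ⟨hball _ (clamp_mem hM _) _ (clamp_mem hA _), x.2.2⟩
  refine ⟨fun y => (ContinuousMap.curry ⟨_, hcont⟩) y, map_continuous _, fun m hm a ha => ?_⟩
  obtain ⟨h0, hder⟩ := hα _ (hball m hm a ha)
  have hma : clamp M m = m := clamp_of_abs_le (abs_le.mpr hm)
  have haa : clamp A a = a := clamp_of_abs_le (abs_le.mpr ha)
  have hu : ∀ t (ht : t ∈ Set.Icc (0 : ℝ) 1),
      ext ((ContinuousMap.curry ⟨_, hcont⟩) (m, a)) t = (α ((0, a, m), t)).1 := by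
    intro t ht
    rw [ext_of_mem _ ht]
    simp [hma, haa]
  have h0m : (0 : ℝ) ∈ Set.Icc (0 : ℝ) 1 := by norm_num
  have hd1 : ∀ t ∈ Set.Icc (0 : ℝ) 1, HasDerivWithinAt (fun t => (α ((0, a, m), t)).1)
      (clamp V (α ((0, a, m), t)).2.1) (Set.Icc 0 1) t := fun t ht =>
    (ContinuousLinearMap.fst ℝ ℝ (ℝ × ℝ)).hasFDerivAt.comp_hasDerivWithinAt t (hder t ht)
  have hd' : ∀ t ∈ Set.Icc (0 : ℝ) 1, HasDerivWithinAt (fun t => (α ((0, a, m), t)).2)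
      (shootingField V M p g t (α ((0, a, m), t))).2 (Set.Icc 0 1) t := fun t ht =>
    (ContinuousLinearMap.snd ℝ ℝ (ℝ × ℝ)).hasFDerivAt.comp_hasDerivWithinAt t (hder t ht)
  have hd2 : ∀ t ∈ Set.Icc (0 : ℝ) 1, HasDerivWithinAt (fun t => (α ((0, a, m), t)).2.1)
      (shootingField V M p g t (α ((0, a, m), t))).2.1 (Set.Icc 0 1) t := fun t ht =>
    (ContinuousLinearMap.fst ℝ ℝ ℝ).hasFDerivAt.comp_hasDerivWithinAt t (hd' t ht)
  have hd3 : ∀ t ∈ Set.Icc (0 : ℝ) 1, HasDerivWithinAt (fun t => (α ((0, a, m), t)).2.2)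
      0 (Set.Icc 0 1) t := fun t ht =>
    (ContinuousLinearMap.snd ℝ ℝ ℝ).hasFDerivAt.comp_hasDerivWithinAt t (hd' t ht)
  have hm' : ∀ t ∈ Set.Icc (0 : ℝ) 1, (α ((0, a, m), t)).2.2 = m := by
    intro t ht
    have := (convex_Icc (0 : ℝ) 1).norm_image_sub_le_of_norm_hasDerivWithin_le (C := 0)
      hd3 (fun _ _ => by simp) h0m ht
    rw [zero_mul, norm_le_zero_iff, sub_eq_zero] at this
    rw [this, h0]
  have hz : ∀ t ∈ Set.Icc (0 : ℝ) 1, |(α ((0, a, m), t)).2.1 - a| ≤ M * B := by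
    intro t ht
    have := (convex_Icc (0 : ℝ) 1).norm_image_sub_le_of_norm_hasDerivWithin_le (C := M * B)
      hd2 (fun s _ => abs_shootingField_snd_le hM hp hg s _) h0m ht
    rw [h0] at this
    refine this.trans (mul_le_of_le_one_right hMB ?_)
    rw [sub_zero, Real.norm_of_nonneg ht.1]
    exact ht.2
  refine ⟨?_, fun t => (α ((0, a, m), t)).2.1, hz, fun t ht => ?_⟩
  · simp [hma, haa, h0]
  · have ht' := Set.Ioo_subset_Icc_self ht
    have hn : Set.Icc (0 : ℝ) 1 ∈ nhds t := Icc_mem_nhds ht.1 ht.2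
    have hcl : clamp V (α ((0, a, m), t)).2.1 = (α ((0, a, m), t)).2.1 := by
      refine clamp_of_abs_le ?_
      have h1 := hz t ht'
      have h2 := abs_le.mpr ha
      have h3 := abs_add_le ((α ((0, a, m), t)).2.1 - a) a
      rw [sub_add_cancel] at h3
      linarith
    constructor
    · have := (hd1 t ht').hasDerivAt hn
      rw [hcl] at this
      exact this.congr_of_eventuallyEq (Filter.eventually_of_mem hn fun s hs => hu s hs)
    · have := (hd2 t ht').hasDerivAt hn
      simpa [shootingField, hm' t ht', hma, hu t ht'] using this

end DirichletExample

/-! ### Solutions of the integral equation -/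

namespace DirichletExample

lemma integral_exp_ext_pos (u : C(unitInterval, ℝ)) :
    0 < ∫ x in (0 : ℝ)..1, Real.exp (ext u x) :=
  intervalIntegral.intervalIntegral_pos_of_pos
    (Continuous.intervalIntegrable (Real.continuous_exp.comp (continuous_ext u)) _ _)
    (fun _ => Real.exp_pos _) zero_lt_one

@[fun_prop]
lemma continuous_exp_ext (u : C(unitInterval, ℝ)) : Continuous fun x => Real.exp (ext u x) :=
  Real.continuous_exp.comp (continuous_ext u)

@[fun_prop]
lemma continuous_rhs (u : C(unitInterval, ℝ)) : Continuous (rhs u) := by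
  unfold rhs
  fun_prop

lemma abs_ext_le (u : C(unitInterval, ℝ)) (t : ℝ) : |ext u t| ≤ ‖u‖ :=
  u.norm_coe_le_norm _

lemma solvesIntegralEq_iff (l : ℝ) (u : C(unitInterval, ℝ)) :
    SolvesIntegralEq l u ↔
      ∀ t ∈ Set.Icc (0 : ℝ) 1, ext u t = greenPotential (fun s => l * rhs u s) t := by
  have h : ∀ t ∈ Set.Icc (0 : ℝ) 1, l * ∫ s in (0 : ℝ)..1, green t s * rhs u s =
      greenPotential (fun s => l * rhs u s) t := by
    intro t ht
    rw [← integral_green_eq_greenPotential (by fun_prop) ht,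
      ← intervalIntegral.integral_const_mul]
    congr 1; funext s; ring
  constructor
  · intro hu t ht
    rw [ext_of_mem u ht, hu ⟨t, ht⟩, h t ht]
  · intro hu t
    rw [h t t.2, ← hu t t.2, ext_of_mem u t.2]

/-- The integral equation and the boundary value problem have the same solutions. -/
lemma solvesIntegralEq_iff_solvesBVP (l : ℝ) (u : C(unitInterval, ℝ)) :
    SolvesIntegralEq l u ↔ SolvesBVP l u := by
  have hq : Continuous fun s => l * rhs u s := by fun_prop
  have h0 : ext u 0 = u 0 := ext_of_mem u (by norm_num)
  have h1 : ext u 1 = u 1 := ext_of_mem u (by norm_num)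
  rw [solvesIntegralEq_iff]
  constructor
  · intro hu
    refine ⟨fun t ht => ?_, ?_, ?_⟩
    · have he : ext u =ᶠ[nhds t] greenPotential fun s => l * rhs u s :=
        Filter.eventually_of_mem (Icc_mem_nhds ht.1 ht.2) hu
      exact ⟨((hasDerivAt_greenPotential hq t).congr_of_eventuallyEq he).differentiableAt,
        (hasDerivAt_deriv_greenPotential hq t).congr_of_eventuallyEq he.deriv⟩
    · rw [← h0, hu 0 (by norm_num), greenPotential_zero]
    · rw [← h1, hu 1 (by norm_num), greenPotential_one]
  · rintro ⟨hd, hu0, hu1⟩ t ht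
    exact eq_greenPotential hq (continuous_ext u).continuousOn
      (fun t ht => (hd t ht).1.hasDerivAt) (fun t ht => (hd t ht).2)
      (h0.trans hu0) (h1.trans hu1) ht

lemma exp_div_integral_mem (u : C(unitInterval, ℝ)) (t : ℝ) :
    Real.exp (ext u t) / (∫ x in (0 : ℝ)..1, Real.exp (ext u x)) ∈
      Set.Icc (Real.exp (-2 * ‖u‖)) (Real.exp (2 * ‖u‖)) := by
  have hI := integral_exp_ext_pos u
  have hb : ∀ s, -‖u‖ ≤ ext u s ∧ ext u s ≤ ‖u‖ := fun s => abs_le.mp (abs_ext_le u s)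
  have hup : ∫ x in (0 : ℝ)..1, Real.exp (ext u x) ≤ Real.exp ‖u‖ := by
    have := intervalIntegral.integral_mono_on (μ := MeasureTheory.volume) zero_le_one
      (Continuous.intervalIntegrable (continuous_exp_ext u) 0 1)
      (intervalIntegrable_const (c := Real.exp ‖u‖)) (fun s _ => Real.exp_le_exp.mpr (hb s).2)
    simpa using this
  have hlo : Real.exp (-‖u‖) ≤ ∫ x in (0 : ℝ)..1, Real.exp (ext u x) := by
    have := intervalIntegral.integral_mono_on (μ := MeasureTheory.volume) zero_le_one
      (intervalIntegrable_const (c := Real.exp (-‖u‖)))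
      (Continuous.intervalIntegrable (continuous_exp_ext u) 0 1)
      (fun s _ => Real.exp_le_exp.mpr (hb s).1)
    simpa using this
  constructor
  · rw [le_div_iff₀ hI]
    calc Real.exp (-2 * ‖u‖) * ∫ x in (0 : ℝ)..1, Real.exp (ext u x)
        ≤ Real.exp (-2 * ‖u‖) * Real.exp ‖u‖ := by gcongr
      _ = Real.exp (-‖u‖) := by rw [← Real.exp_add]; ring_nf
      _ ≤ Real.exp (ext u t) := Real.exp_le_exp.mpr (hb t).1
  · rw [div_le_iff₀ hI]
    calc Real.exp (ext u t) ≤ Real.exp ‖u‖ := Real.exp_le_exp.mpr (hb t).2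
      _ = Real.exp (2 * ‖u‖) * Real.exp (-‖u‖) := by rw [← Real.exp_add]; ring_nf
      _ ≤ Real.exp (2 * ‖u‖) * ∫ x in (0 : ℝ)..1, Real.exp (ext u x) := by gcongr

/-- `lowerF ‖u‖` bounds the integral operator from below at `u`. -/
lemma lowerF_le_integral (u : C(unitInterval, ℝ)) {t : ℝ} (ht : t ∈ Set.Icc (0 : ℝ) 1) :
    lowerF ‖u‖ t ≤ ∫ s in (0 : ℝ)..1, green t s * rhs u s := by
  refine (weighted_integral_green_ge (w := fun s => Real.exp (ext u s) /
    ∫ x in (0 : ℝ)..1, Real.exp (ext u x)) (by fun_prop)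
    (fun s _ => exp_div_integral_mem u s) ht).trans_eq ?_
  simp only [rhs, mul_div_assoc]

lemma abs_le_of_solvesIntegralEq {l : ℝ} {u : C(unitInterval, ℝ)}
    (h : SolvesIntegralEq l u) {t : ℝ} (ht : t ∈ Set.Icc (0 : ℝ) 1) (hF : 0 < lowerF ‖u‖ t) :
    |l| ≤ ‖u‖ / lowerF ‖u‖ t := by
  rw [le_div_iff₀ hF]
  have h1 := lowerF_le_integral u ht
  calc |l| * lowerF ‖u‖ t ≤ |l| * ∫ s in (0 : ℝ)..1, green t s * rhs u s := by gcongr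
    _ = |l * ∫ s in (0 : ℝ)..1, green t s * rhs u s| := by
      rw [abs_mul, abs_of_nonneg (hF.le.trans h1)]
    _ = ‖u ⟨t, ht⟩‖ := by rw [h ⟨t, ht⟩, Real.norm_eq_abs]
    _ ≤ ‖u‖ := u.norm_coe_le_norm _

/-- The mean value theorem on `[0,1]`. -/
lemma exists_increment_eq_deriv {w z : ℝ → ℝ} (hw : Continuous w)
    (hd : ∀ t ∈ Set.Ioo (0 : ℝ) 1, HasDerivAt w (z t) t) :
    ∃ t ∈ Set.Icc (0 : ℝ) 1, w 1 - w 0 = z t := by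
  obtain ⟨c, hc, hc'⟩ := exists_hasDerivAt_eq_slope w z zero_lt_one hw.continuousOn hd
  exact ⟨c, Set.Ioo_subset_Icc_self hc, by rw [hc']; simp⟩

/-- For either sign `σ`, the problem has a solution of norm `ρ` whose parameter has the sign of `σ`.
After truncation of the exponential, the two equations `u(1) = 0` and `‖u - u(1) t‖ = ρ` in the
coefficient `ν` and the initial slope `a` are solved by the Poincaré–Miranda theorem. -/
lemma exists_solution {ρ : ℝ} (hρ0 : 0 < ρ)
    (hρ : ρ < Real.log ((4 * Real.pi / (Real.pi - 2)) ^ (1 / 4 : ℝ))) {σ : ℝ} (hσ : |σ| = 1) :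
    ∃ l : ℝ, 0 < σ * l ∧ ∃ u : C(unitInterval, ℝ), ‖u‖ = ρ ∧ SolvesIntegralEq l u := by
  set c : ℝ := Real.exp ρ * lowerF ρ (tpt ρ) with hc
  have hc0 : 0 < c := mul_pos (Real.exp_pos _) (lowerF_tpt_pos hρ)
  set M : ℝ := (ρ + 1) / c with hM
  have hMpos : 0 < M := by positivity
  have hMc : M * c = ρ + 1 := div_mul_cancel₀ _ hc0.ne'
  set A : ℝ := M * Real.exp ρ + 1 with hA
  have hA0 : 0 ≤ A := by positivity
  set g : ℝ → ℝ := fun x => Real.exp (clamp ρ x) with hg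
  have hgc : Continuous g := by fun_prop
  have hgmem : ∀ x, g x ∈ Set.Icc (Real.exp ρ * Real.exp (-2 * ρ)) (Real.exp ρ * Real.exp (2 * ρ)) :=
    fun x => by
    rw [← Real.exp_add, ← Real.exp_add]
    exact ⟨Real.exp_le_exp.mpr (by linarith [(clamp_mem hρ0.le x).1]),
      Real.exp_le_exp.mpr (by linarith [(clamp_mem hρ0.le x).2])⟩
  obtain ⟨u, huc, hu⟩ := exists_shooting_family (M := M) (A := A) (B := Real.exp ρ)
    (K := Real.exp ρ) (p := fun t => Real.sin (3 / 2 * Real.pi * t)) (g := g) hMpos.le hA0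
    (Real.exp_pos _).le (by fun_prop) (fun t => Real.abs_sin_le_one _)
    (fun x => by rw [Real.abs_exp]; exact Real.exp_le_exp.mpr (clamp_mem hρ0.le x).2)
    (abs_exp_clamp_sub_le hρ0.le)
  have hσM : ∀ ν ∈ Set.Icc 0 M, σ * ν ∈ Set.Icc (-M) M := fun ν hν => by
    rw [Set.mem_Icc, ← abs_le, abs_mul, hσ, one_mul, abs_of_nonneg hν.1]
    exact hν.2
  -- the deviation of the shot from the line through its endpoints
  set v : ℝ × ℝ → C(unitInterval, ℝ) := fun y =>
    u (σ * y.1, y.2) - u (σ * y.1, y.2) 1 • ⟨fun t => (t : ℝ), by fun_prop⟩ with hv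
  have huc' : Continuous fun y : ℝ × ℝ => u (σ * y.1, y.2) := huc.comp (by fun_prop)
  have hu1c : Continuous fun y : ℝ × ℝ => u (σ * y.1, y.2) 1 :=
    (ContinuousEvalConst.continuous_eval_const (1 : unitInterval)).comp huc'
  have hvc : Continuous v := huc'.sub (hu1c.smul continuous_const)
  set q : ℝ × ℝ → ℝ → ℝ := fun y s =>
    Real.sin (3 / 2 * Real.pi * s) * g (ext (u (σ * y.1, y.2)) s) with hq
  have hqc : ∀ y, Continuous (q y) := fun y => by
    have := hgc.comp (continuous_ext (u (σ * y.1, y.2)))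
    exact Continuous.mul (by fun_prop) this
  have hvG : ∀ ν ∈ Set.Icc 0 M, ∀ a ∈ Set.Icc (-A) A, ∀ t : unitInterval,
      v (ν, a) t = σ * ν * ∫ s in (0 : ℝ)..1, green t s * q (ν, a) s := by
    intro ν hν a ha t
    obtain ⟨h0, z, -, hz⟩ := hu _ (hσM ν hν) a ha
    have h := eq_greenPotential (q := fun s => σ * ν * q (ν, a) s)
      (w := fun t => ext (u (σ * ν, a)) t - u (σ * ν, a) 1 * t)
      (z := fun t => z t - u (σ * ν, a) 1) (continuous_const.mul (hqc _))
      ((continuous_ext _).sub (by fun_prop)).continuousOn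
      (fun t ht => by
        simpa using (hz t ht).1.fun_sub ((hasDerivAt_id t).const_mul (u (σ * ν, a) 1)))
      (fun t ht => (hz t ht).2.sub_const _)
      (by rw [ext_of_mem _ (by norm_num)]; simpa using h0)
      (by rw [ext_of_mem _ (by norm_num), mul_one]; exact sub_self _) t.2
    have hqc' : Continuous fun s => σ * ν * q (ν, a) s := continuous_const.mul (hqc _)
    rw [ext_of_mem _ t.2, ← integral_green_eq_greenPotential hqc' t.2] at h
    rw [← intervalIntegral.integral_const_mul]
    refine Eq.trans ?_ (h.trans ?_)
    · simp [hv]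
    · congr 1; funext s; ring
  have hslope : ∀ ν ∈ Set.Icc 0 M, ∀ a ∈ Set.Icc (-A) A,
      |u (σ * ν, a) 1 - a| ≤ M * Real.exp ρ := by
    intro ν hν a ha
    obtain ⟨h0, z, hza, hz⟩ := hu _ (hσM ν hν) a ha
    obtain ⟨s, hs, hs'⟩ := exists_increment_eq_deriv (continuous_ext _) fun t ht => (hz t ht).1
    rw [ext_of_mem _ (by norm_num : (1 : ℝ) ∈ Set.Icc (0 : ℝ) 1),
      ext_of_mem _ (by norm_num : (0 : ℝ) ∈ Set.Icc (0 : ℝ) 1)] at hs'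
    have h1 : u (σ * ν, a) 1 = z s := by
      rw [← hs']
      exact (sub_eq_self.mpr h0).symm
    rw [h1]
    exact hza s hs
  have hAA : A ∈ Set.Icc (-A) A := ⟨by linarith, le_rfl⟩
  have hAA' : -A ∈ Set.Icc (-A) A := ⟨le_rfl, by linarith⟩
  obtain ⟨⟨ν, a⟩, ⟨hν, ha⟩, hend, hnorm⟩ := poincare_miranda_plane
    (f := fun y : ℝ × ℝ => u (σ * y.1, y.2) 1) (g := fun y => ‖v y‖ - ρ)
    (a := 0) (b := M) (c := -A) (d := A) hMpos.le (by linarith)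
    hu1c.continuousOn (hvc.norm.sub continuous_const).continuousOn
    (fun a ha => by
      have : v (0, a) = 0 := by
        ext t
        rw [hvG 0 ⟨le_rfl, hMpos.le⟩ a ha t]
        simp
      simp only [this, norm_zero]
      linarith)
    (fun a ha => by
      -- the Green potential at `tpt ρ` is at least `c`, and `M * c` exceeds `ρ`
      have h1 := weighted_integral_green_ge (w := fun s => g (ext (u (σ * M, a)) s))
        (hgc.comp (continuous_ext _)) (fun s _ => hgmem _) (tpt_mem_Icc ρ)
      have h2 : c ≤ ∫ s in (0 : ℝ)..1, green (tpt ρ) s * q (M, a) s := by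
        refine le_trans (le_of_eq ?_) h1
        rw [hc, lowerF, mul_add, ← mul_assoc, ← mul_assoc]
      have h3 := (v (M, a)).norm_coe_le_norm ⟨tpt ρ, tpt_mem_Icc ρ⟩
      rw [hvG M ⟨hMpos.le, le_rfl⟩ a ha, Real.norm_eq_abs, abs_mul, abs_mul, hσ, one_mul,
        abs_of_pos hMpos] at h3
      have h4 := mul_le_mul_of_nonneg_left (h2.trans (le_abs_self _)) hMpos.le
      change 0 < ‖v (M, a)‖ - ρ
      linarith)
    (fun ν hν => by
      have := (abs_le.mp (hslope ν hν _ hAA')).2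
      change u (σ * ν, -A) 1 < 0
      linarith)
    (fun ν hν => by
      have := (abs_le.mp (hslope ν hν _ hAA)).1
      change 0 < u (σ * ν, A) 1
      linarith)
  simp only at hν ha hend hnorm
  have hvu : v (ν, a) = u (σ * ν, a) := by simp [hv, hend]
  rw [hvu, sub_eq_zero] at hnorm
  have hνpos : 0 < ν := by
    refine hν.1.lt_of_ne fun h => ?_
    have : u (σ * ν, a) = 0 := by
      ext t
      rw [← hvu, hvG ν hν a ha t, ← h]
      simp
    rw [this, norm_zero] at hnorm
    exact hρ0.ne hnorm
  have hI := integral_exp_ext_pos (u (σ * ν, a))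
  refine ⟨σ * ν * ∫ x in (0 : ℝ)..1, Real.exp (ext (u (σ * ν, a)) x), ?_, u (σ * ν, a), hnorm,
    fun t => ?_⟩
  · have hσσ : σ * σ = 1 := by rw [← abs_mul_abs_self, hσ, one_mul]
    rw [← mul_assoc, ← mul_assoc, hσσ, one_mul]
    exact mul_pos hνpos hI
  · -- the norm of `u` is `ρ`, so the truncation is not active
    have hqr : ∀ s, q (ν, a) s =
        (∫ x in (0 : ℝ)..1, Real.exp (ext (u (σ * ν, a)) x)) * rhs (u (σ * ν, a)) s := by
      intro s
      simp only [hq, hg, rhs, clamp_of_abs_le ((abs_ext_le _ s).trans hnorm.le)]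
      field_simp
    have hut : u (σ * ν, a) t = v (ν, a) t := by rw [hvu]
    rw [hut, hvG ν hν a ha t, mul_assoc (σ * ν)]
    congr 1
    rw [← intervalIntegral.integral_const_mul]
    congr 1
    funext s
    rw [hqr]
    ring

end DirichletExample

theorem mainTheorem3 (ρ : ℝ) (hρ : 0 < ρ)
    (hρ' : ρ < Real.log ((4 * Real.pi / (Real.pi - 2)) ^ (1 / 4 : ℝ))) :
    (∃ l : ℝ, 0 < l ∧ ∃ u : C(unitInterval, ℝ), ‖u‖ = ρ ∧
      DirichletExample.SolvesIntegralEq l u ∧ DirichletExample.SolvesBVP l u) ∧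
    (∃ l : ℝ, l < 0 ∧ ∃ u : C(unitInterval, ℝ), ‖u‖ = ρ ∧
      DirichletExample.SolvesIntegralEq l u ∧ DirichletExample.SolvesBVP l u) ∧
    DirichletExample.tpt ρ ∈ Set.Icc (0 : ℝ) 1 ∧
    IsMaxOn (DirichletExample.lowerF ρ) (Set.Icc (0 : ℝ) 1) (DirichletExample.tpt ρ) ∧
    0 < DirichletExample.lowerF ρ (DirichletExample.tpt ρ) ∧
    (∀ (l : ℝ) (u : C(unitInterval, ℝ)), ‖u‖ = ρ →
      (DirichletExample.SolvesIntegralEq l u ∨ DirichletExample.SolvesBVP l u) →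
      |l| ≤ ρ / DirichletExample.lowerF ρ (DirichletExample.tpt ρ)) := by
  have hF := DirichletExample.lowerF_tpt_pos hρ'
  refine ⟨?_, ?_, DirichletExample.tpt_mem_Icc ρ, DirichletExample.isMaxOn_lowerF hρ', hF, ?_⟩
  · obtain ⟨l, hl, u, hu, hs⟩ := DirichletExample.exists_solution hρ hρ' (σ := 1) (by simp)
    exact ⟨l, by linarith, u, hu, hs, (DirichletExample.solvesIntegralEq_iff_solvesBVP l u).mp hs⟩
  · obtain ⟨l, hl, u, hu, hs⟩ := DirichletExample.exists_solution hρ hρ' (σ := -1) (by simp)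
    exact ⟨l, by linarith, u, hu, hs, (DirichletExample.solvesIntegralEq_iff_solvesBVP l u).mp hs⟩
  · rintro l u rfl hs
    exact DirichletExample.abs_le_of_solvesIntegralEq
      (hs.elim id (DirichletExample.solvesIntegralEq_iff_solvesBVP l u).mpr)
      (DirichletExample.tpt_mem_Icc _) hF
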